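/- For integers $0<m<n$ let $x_k^n=\cos\frac{(2k-1)\pi}{2n}$ ($1\le k\le n$) be the Chebyshev zeros, $X_n=\{x_1^n,\dots,x_n^n\}$, and let $w(x)=(1-x^2)^{-1/2}$. Let $p_0=\sqrt{1/\pi}$ and $p_r(x)=\sqrt{2/\pi}\,\cos(r\arccos x)$ for $r\ge 1$ be the orthonormal Chebyshev polynomials of the first kind. Put $\mu_{n,r}^m=\frac{m+n-r}{2m}$ for $n-m<r<n+m$, and for $0\le r<n$ $$q_{n,r}^m=\begin{cases}p_r,& r\le n-m,\\ \mu_{n,r}^m\,p_r-\mu_{n,2n-r}^m\,p_{2n-r},& n-m<r<n,\end{cases}\qquad \nu_{n,r}^m=\begin{cases}1,& r\le n-m,\\ \frac{m^2+(n-r)^2}{2m^2},& n-m<r<n.\end{cases}$$ The orthonormal de la Vallée Poussin scaling functions are $$\tilde\varphi_{n,k}^m(x)=\sum_{r=0}^{n-1}\sqrt{\frac{\pi}{n\,\nu_{n,r}^m}}\;p_r(x_k^n)\,q_{n,r}^m(x),\qquad k=1,\dots,n,$$ and, for a real function $f$ defined everywhere on $[-1,1]$, the operator $\tilde S_n^m$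 is obtained from the Fourier sum $\sum_k\langle f,\tilde\varphi_{n,k}^m\rangle_{L^2_w}\tilde\varphi_{n,k}^m$ by Gauss–Chebyshev quadrature of the coefficients: $$\tilde S_n^m f(x)=\sum_{k=1}^n\Big[\frac{\pi}{n}\sum_{i=1}^n f(x_i^n)\,\tilde\varphi_{n,k}^m(x_i^n)\Big]\tilde\varphi_{n,k}^m(x).$$ Let $\|f\|_\infty=\sup_{|x|\le1}|f(x)|$, $\|f\|_{\ell^\infty(X_n)}=\max_{1\le k\le n}|f(x_k^n)|$ and, for $1\le p<\infty$, $\|f\|_p=\big(\int_{-1}^1|f|^p\,w\,dx\big)^{1/p}$, $\|f\|_{\ell^p(X_n)}=\big(\frac{\pi}{n}\sum_{k=1}^n|f(x_k^n)|^p\big)^{1/p}$. Let $E_N(f)_\infty$ be the infimum of $\|f-P\|_\infty$ over the real polynomials $P$ of degree at most $N$. **Theorem.** Fix $\theta\in(0,1)$; below, $m=\lfloor\theta n\rfloor$. 1. For every $1\le p\le\infty$ there is a constant $\mathcal C_p>0$, depending only on $p$ and on the fixed $\theta$, such that for all $n\in\mathbb N$ with $m\ge1$ and all functions $f:[-1,1]\to\mathbb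 R$, $$\|\tilde S_n^m f\|_p\le \mathcal C_p\,\|f\|_{\ell^p(X_n)}.$$ 2. For every continuous $f:[-1,1]\to\mathbb R$, $\tilde S_n^m f$ converges to $f$ uniformly on $[-1,1]$ as $n\to\infty$. 3. There is a constant $\mathcal C>0$, depending only on $\theta$ (not on $f$, $n$, $m$), such that for all $n\in\mathbb N$ with $m\ge1$ and all continuous $f:[-1,1]\to\mathbb R$, $$E_{n+m-1}(f)_\infty\le\|\tilde S_n^m f-f\|_\infty\le \mathcal C\,E_{n-m}(f)_\infty .$$ -/

import Mathlib

open Polynomial Filter Topology MeasureTheory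
open scoped NNReal ENNReal

noncomputable section

namespace VP

/-- The Chebyshev zeros `x_k^n = cos ((2k-1)π/(2n))`, for `k = 1, …, n`. -/
def node (n k : ℕ) : ℝ := Real.cos ((2 * (k : ℝ) - 1) * Real.pi / (2 * (n : ℝ)))

/-- The orthonormal Chebyshev polynomial `p_r` of the first kind, of degree `r`. -/
def orthoCheb (r : ℕ) : ℝ[X] :=
  C (if r = 0 then √(1 / Real.pi) else √(2 / Real.pi)) * Polynomial.Chebyshev.T ℝ (r : ℤ)

/-- On `[-1,1]`, `p_r(x) = cos (r arccos x)` times the normalizing factor. -/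
theorem orthoCheb_eval (r : ℕ) {x : ℝ} (hx : x ∈ Set.Icc (-1 : ℝ) 1) :
    (orthoCheb r).eval x =
      Real.cos ((r : ℝ) * Real.arccos x) *
        (if r = 0 then √(1 / Real.pi) else √(2 / Real.pi)) := by
  have h := Polynomial.Chebyshev.T_real_cos (Real.arccos x) (r : ℤ)
  rw [Real.cos_arccos hx.1 hx.2] at h
  rw [orthoCheb, eval_mul, eval_C, h, mul_comm]
  simp

/-- The de la Vallée Poussin coefficients `μ_{n,r}^m`. The condition `r ≤ n - m` is written
`r + m ≤ n`. -/
def mu (n m r : ℕ) : ℝ :=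
  if r + m ≤ n then 1
  else if r < n + m then ((m : ℝ) + (n : ℝ) - (r : ℝ)) / (2 * (m : ℝ))
  else 0

/-- The orthogonal basis `q_{n,r}^m`, `0 ≤ r < n`, of the sampling space. -/
def q (n m r : ℕ) : ℝ[X] :=
  if r + m ≤ n then orthoCheb r
  else C (mu n m r) * orthoCheb r - C (mu n m (2 * n - r)) * orthoCheb (2 * n - r)

/-- The squared norms `ν_{n,r}^m`, `0 ≤ r < n`, of the basis `q_{n,r}^m`. -/
def nu (n m r : ℕ) : ℝ :=
  if r + m ≤ n then 1
  else ((m : ℝ) ^ 2 + ((n : ℝ) - (r : ℝ)) ^ 2) / (2 * (m : ℝ) ^ 2)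

/-- The coefficients `τ_{r,k}^n = √(π / (n ν_{n,r}^m)) p_r(x_k^n)`. -/
def tau (n m r k : ℕ) : ℝ :=
  √(Real.pi / ((n : ℝ) * nu n m r)) * (orthoCheb r).eval (node n k)

/-- The orthonormal VP scaling functions `φ̃_{n,k}^m`, `k = 1, …, n`. -/
def scaling (n m k : ℕ) : ℝ[X] :=
  ∑ r ∈ Finset.range n, C (tau n m r k) * q n m r

/-- The discrete operator `S̃_n^m`: the Fourier coefficients `⟨f, φ̃_{n,k}^m⟩` are replaced by
their Gauss–Chebyshev quadrature sums on the `n` Chebyshev zeros. -/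
def discreteProj (n m : ℕ) (f : ℝ → ℝ) : ℝ[X] :=
  ∑ k ∈ Finset.Icc 1 n,
    C (Real.pi / (n : ℝ) *
      ∑ i ∈ Finset.Icc 1 n, f (node n i) * (scaling n m k).eval (node n i)) * scaling n m k

/-- The norm `‖f‖_p` (`1 ≤ p ≤ ∞`), with values in `[0,∞]`: the supremum over `[-1,1]` if `p = ∞`,
and `(∫_{-1}^1 |f|^p w)^{1/p}` with `w(x) = 1/√(1-x²)` otherwise (`measureT` is the measure
`w(x) dx` on `(-1,1]`). -/
def wNorm (p : ℝ≥0∞) (f : ℝ → ℝ) : ℝ≥0∞ :=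
  if p = ∞ then ⨆ x ∈ Set.Icc (-1 : ℝ) 1, ‖f x‖ₑ
  else eLpNorm f p Polynomial.Chebyshev.measureT

/-- The discrete norm `‖f‖_{ℓ^p(X_n)}` (`1 ≤ p ≤ ∞`), with values in `[0,∞]`. -/
def discreteNorm (p : ℝ≥0∞) (n : ℕ) (f : ℝ → ℝ) : ℝ≥0∞ :=
  if p = ∞ then ⨆ k ∈ Finset.Icc 1 n, ‖f (node n k)‖ₑ
  else (ENNReal.ofReal (Real.pi / (n : ℝ)) *
    ∑ k ∈ Finset.Icc 1 n, ‖f (node n k)‖ₑ ^ p.toReal) ^ (1 / p.toReal)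

/-- The error `E_N(f)_p` of best approximation by real polynomials of degree at most `N`. -/
def bestApprox (N : ℕ) (p : ℝ≥0∞) (f : ℝ → ℝ) : ℝ≥0∞ :=
  ⨅ P : {P : ℝ[X] // P.natDegree ≤ N}, wNorm p (fun x => f x - P.1.eval x)

end VP

end

namespace VP

/-! The discrete operator is a sum over the nodes of `f (node n i)` times a cardinal kernel `K_i`.
Schur's test reduces the norm bound, for all `p` and with one constant `A = 68 n / m`, to `∑ i, |K_i
x| ≤ A` on `[-1,1]` and `∫ |K_i| w ≤ A π / n`; for `m = ⌊θ n⌋ ≥ 1` the ratio `n / m` is at most `2 /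
θ`.

To see the kernel, discrete orthogonality collapses the sum over scaling functions to `∑ r, ν_r⁻¹
q_r(x_i) q_r(x)`. Since `T_{2n-r} = -T_r` at the nodes, `q_r(x_i) = p_r(x_i)`, and the sum unfolds
to `K_i = n⁻¹ ∑_{j<2n} λ_j ε_j T_j(x_i) T_j(x)`, where `λ` is `multiplier`. Two summations by parts
turn this into second differences of `λ` against Fejér-type kernels, which are nonnegative
(`doubleSum_kernelTerm_nonneg`), so their nodal sums and integrals are read off from the constant
term. The second differences are `O(1/m²)` on the transition band and `O(1/m)` at its two corners,
of total mass at most `34 / m` (`sum_abs_secondDiff_multiplier_le`).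

The operator reproduces polynomials of degree at most `n - m` (`eval_discreteProj_polynomial`), so
Lebesgue's argument bounds the error by the best approximation, and Weierstrass' theorem gives
uniform convergence. The lower bound for the error holds because the output has degree at most `n +
m - 1`. -/

/-! ### Double summation by parts and nonnegative Fejér-type kernels. -/

/-- The weights `1, 2, 2, …` of the cosine expansion of an even trigonometric kernel. -/
noncomputable def cosWeight (j : ℕ) : ℝ := if j = 0 then 1 else 2

/-- The terms `ε_j T_j(y) T_j(x)` of the Chebyshev kernels. -/
noncomputable def kernelTerm (y x : ℝ) (j : ℕ) : ℝ :=
  cosWeight j * (Chebyshev.T ℝ (j : ℤ)).eval y * (Chebyshev.T ℝ (j : ℤ)).eval x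

/-- The second iterated partial sums of a sequence. -/
def doubleSum (a : ℕ → ℝ) (k : ℕ) : ℝ := ∑ i ∈ Finset.range k, ∑ j ∈ Finset.range (i + 1), a j

/-- Second forward differences of a sequence. -/
def secondDiff (c : ℕ → ℝ) (k : ℕ) : ℝ := c k - 2 * c (k + 1) + c (k + 2)

theorem sum_mul_eq_sum_secondDiff_mul_doubleSum_add (a c : ℕ → ℝ) (N : ℕ) :
    ∑ j ∈ Finset.range N, c j * a j =
      ∑ k ∈ Finset.range N, secondDiff c k * doubleSum a (k + 1) +
        (c N * ∑ j ∈ Finset.range N, a j + (c N - c (N + 1)) * doubleSum a N) := by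
  induction N with
  | zero => simp [doubleSum]
  | succ N ih =>
    rw [Finset.sum_range_succ, ih, Finset.sum_range_succ _ N]
    have h : doubleSum a (N + 1) = doubleSum a N + ∑ j ∈ Finset.range (N + 1), a j := by
      simp [doubleSum, Finset.sum_range_succ _ N]
    rw [h, Finset.sum_range_succ a N, secondDiff]
    ring

theorem sum_mul_eq_sum_secondDiff_mul_doubleSum (a c : ℕ → ℝ) (N : ℕ) (h0 : c N = 0)
    (h1 : c (N + 1) = 0) :
    ∑ j ∈ Finset.range N, c j * a j =
      ∑ k ∈ Finset.range N, secondDiff c k * doubleSum a (k + 1) := by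
  rw [sum_mul_eq_sum_secondDiff_mul_doubleSum_add, h0, h1]
  ring

/-- Dirichlet kernel identity: the three-term recurrence makes the sum telescope. Keeping `1 - z` as
a factor avoids division. -/
theorem one_sub_mul_sum_cosWeight_mul_T (z : ℝ) (k : ℕ) :
    (1 - z) * ∑ j ∈ Finset.range (k + 1), cosWeight j * (Chebyshev.T ℝ (j : ℤ)).eval z =
      (Chebyshev.T ℝ (k : ℤ)).eval z - (Chebyshev.T ℝ ((k : ℤ) + 1)).eval z := by
  induction k with
  | zero => simp [cosWeight]
  | succ k ih =>
    rw [Finset.sum_range_succ, mul_add, ih]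
    have h := congrArg (eval z) (Chebyshev.T_add_two ℝ (k : ℤ))
    simp only [eval_sub, eval_mul, eval_X, eval_ofNat] at h
    push_cast
    rw [show (k : ℤ) + 1 + 1 = k + 2 by ring, h]
    simp [cosWeight]
    ring

theorem one_sub_mul_doubleSum_T (z : ℝ) (k : ℕ) :
    (1 - z) * doubleSum (fun j => cosWeight j * (Chebyshev.T ℝ (j : ℤ)).eval z) k =
      1 - (Chebyshev.T ℝ (k : ℤ)).eval z := by
  rw [doubleSum, Finset.mul_sum]
  simp_rw [one_sub_mul_sum_cosWeight_mul_T]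
  have := Finset.sum_range_sub' (fun k : ℕ => (Chebyshev.T ℝ (k : ℤ)).eval z) k
  push_cast at this
  rw [this]
  simp

theorem cosWeight_pos (j : ℕ) : 0 < cosWeight j := by
  unfold cosWeight; split_ifs <;> norm_num

/-- Fejér positivity: multiplied by `1 - cos t` the double sum becomes `1 - cos (k t) ≥ 0`. The
factor vanishes when `cos t = 1`, where every `T_j` equals `1`. -/
theorem doubleSum_T_nonneg (t : ℝ) (k : ℕ) :
    0 ≤ doubleSum (fun j => cosWeight j * (Chebyshev.T ℝ (j : ℤ)).eval (Real.cos t)) k := by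
  rcases (Real.cos_le_one t).eq_or_lt with h | h
  · simp only [h, Chebyshev.T_eval_one]
    exact Finset.sum_nonneg fun i _ => Finset.sum_nonneg fun j _ => by
      have := cosWeight_pos j; positivity
  · have h1 := one_sub_mul_doubleSum_T (Real.cos t) k
    refine nonneg_of_mul_nonneg_right (a := 1 - Real.cos t) ?_ (by linarith)
    rw [h1, Chebyshev.T_real_cos]
    linarith [Real.cos_le_one (((k : ℤ) : ℝ) * t)]

/-- The product formula for cosines makes the two-variable kernel the average of the one-variable
kernels at `s - t` and `s + t`. -/
theorem doubleSum_kernelTerm_nonneg {y x : ℝ} (hy : y ∈ Set.Icc (-1 : ℝ) 1)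
    (hx : x ∈ Set.Icc (-1 : ℝ) 1) (k : ℕ) : 0 ≤ doubleSum (kernelTerm y x) k := by
  rw [← Real.cos_arccos hy.1 hy.2, ← Real.cos_arccos hx.1 hx.2]
  set s := Real.arccos y
  set t := Real.arccos x
  have key : doubleSum (kernelTerm (Real.cos s) (Real.cos t)) k =
      (doubleSum (fun j => cosWeight j * (Chebyshev.T ℝ (j : ℤ)).eval (Real.cos (s - t))) k +
        doubleSum (fun j => cosWeight j * (Chebyshev.T ℝ (j : ℤ)).eval (Real.cos (s + t))) k)
        / 2 := by
    simp only [doubleSum, ← Finset.sum_add_distrib, Finset.sum_div]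
    refine Finset.sum_congr rfl fun i _ => Finset.sum_congr rfl fun j _ => ?_
    simp only [kernelTerm, Chebyshev.T_real_cos]
    rw [mul_sub, mul_add, Real.cos_sub, Real.cos_add]
    ring
  rw [key]
  have := doubleSum_T_nonneg (s - t) k
  have := doubleSum_T_nonneg (s + t) k
  positivity

/-! ### Nodal sums and integrals of the Fejér-type kernels. -/

theorem node_mem_Icc (n k : ℕ) : node n k ∈ Set.Icc (-1 : ℝ) 1 :=
  ⟨Real.neg_one_le_cos _, Real.cos_le_one _⟩

theorem sumZeroes_eq_sum_node (n : ℕ) (P : ℝ[X]) :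
    Chebyshev.sumZeroes n P = Real.pi / n * ∑ k ∈ Finset.Icc 1 n, P.eval (node n k) := by
  rw [Chebyshev.sumZeroes, ← Finset.Ico_succ_right_eq_Icc, Finset.sum_Ico_eq_sum_range]
  simp only [Nat.succ_eq_succ, Nat.succ_sub_one, node]
  congr 1
  refine Finset.sum_congr rfl fun i _ => ?_
  congr 2
  push_cast
  ring

theorem sum_eval_T_node {n : ℕ} (hn : 0 < n) {k : ℤ} (hk : ¬ (2 * n : ℤ) ∣ k) :
    ∑ i ∈ Finset.Icc 1 n, (Chebyshev.T ℝ k).eval (node n i) = 0 := by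
  have h := Chebyshev.sumZeroes_T_of_not_dvd hk
  rw [sumZeroes_eq_sum_node] at h
  have : (0 : ℝ) < Real.pi / n := by have := Real.pi_pos; positivity
  exact (mul_eq_zero.mp h).resolve_left this.ne'

theorem sum_eval_T_node_of_lt {n : ℕ} (hn : 0 < n) {j : ℕ} (hj : j < 2 * n) :
    ∑ i ∈ Finset.Icc 1 n, (Chebyshev.T ℝ (j : ℤ)).eval (node n i) = if j = 0 then (n : ℝ) else 0 := by
  split_ifs with h
  · simp [h]
  · refine sum_eval_T_node hn fun hd => ?_
    have := Nat.le_of_dvd (by omega) (by exact_mod_cast hd : 2 * n ∣ j)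
    omega

theorem doubleSum_sum {ι : Type*} (s : Finset ι) (a : ι → ℕ → ℝ) (k : ℕ) :
    ∑ i ∈ s, doubleSum (a i) k = doubleSum (fun j => ∑ i ∈ s, a i j) k := by
  simp only [doubleSum]
  rw [Finset.sum_comm]
  refine Finset.sum_congr rfl fun l _ => ?_
  rw [Finset.sum_comm]

theorem doubleSum_of_eq_zero {a : ℕ → ℝ} {k : ℕ} (h : ∀ j < k, j ≠ 0 → a j = 0) :
    doubleSum a k = k * a 0 := by
  rw [doubleSum, Finset.sum_congr rfl (g := fun _ => a 0), Finset.sum_const, Finset.card_range,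
    nsmul_eq_mul]
  intro i hi
  have := Finset.mem_range.mp hi
  rw [Finset.sum_eq_single 0]
  · intro j hj hj0
    have := Finset.mem_range.mp hj
    exact h j (by omega) hj0
  · simp

/-- For `k ≤ 2 * n` only degrees below `2 * n` occur, and there the nodal sum of `T_j` vanishes
unless `j = 0`. Each of the `k` partial sums then contributes its constant term, `n`. -/
theorem sum_node_doubleSum_kernelTerm {n : ℕ} (hn : 0 < n) (x : ℝ) {k : ℕ} (hk : k ≤ 2 * n) :
    ∑ i ∈ Finset.Icc 1 n, doubleSum (kernelTerm (node n i) x) k = n * k := by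
  have h : ∀ j < k, ∑ i ∈ Finset.Icc 1 n, kernelTerm (node n i) x j =
      if j = 0 then (n : ℝ) else 0 := by
    intro j hj
    simp only [kernelTerm]
    rw [← Finset.sum_mul, ← Finset.mul_sum, sum_eval_T_node_of_lt hn (by omega)]
    split_ifs with h0 <;> simp [h0, cosWeight]
  rw [doubleSum_sum, doubleSum_of_eq_zero]
  · rcases Nat.eq_zero_or_pos k with rfl | hk0
    · simp
    · rw [h 0 hk0]; simp [mul_comm]
  · intro j hj hj0
    rw [h j hj, if_neg hj0]

theorem integrable_eval_measureT (P : ℝ[X]) :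
    Integrable (fun x => P.eval x) Chebyshev.measureT :=
  Chebyshev.integrable_measureT P.continuous.continuousOn

theorem integrable_kernelTerm (y : ℝ) (j : ℕ) :
    Integrable (fun x => kernelTerm y x j) Chebyshev.measureT :=
  (integrable_eval_measureT _).const_mul _

theorem integrable_doubleSum_kernelTerm (y : ℝ) (k : ℕ) :
    Integrable (fun x => doubleSum (kernelTerm y x) k) Chebyshev.measureT :=
  integrable_finsetSum _ fun _ _ => integrable_finsetSum _ fun _ _ => integrable_kernelTerm _ _

theorem integral_doubleSum_kernelTerm (y : ℝ) (k : ℕ) :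
    ∫ x, doubleSum (kernelTerm y x) k ∂Chebyshev.measureT = Real.pi * k := by
  have h : ∀ j : ℕ, ∫ x, kernelTerm y x j ∂Chebyshev.measureT = if j = 0 then Real.pi else 0 := by
    intro j
    simp only [kernelTerm]
    rw [integral_const_mul]
    split_ifs with h0
    · have := Chebyshev.integral_eval_T_real_measureT_zero
      subst h0
      simp only [Nat.cast_zero]
      rw [this]
      simp [cosWeight]
    · rw [Chebyshev.integral_eval_T_real_measureT_of_ne_zero (by exact_mod_cast h0), mul_zero]
  have h2 : ∫ x, doubleSum (kernelTerm y x) k ∂Chebyshev.measureT =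
      doubleSum (fun j => ∫ x, kernelTerm y x j ∂Chebyshev.measureT) k := by
    simp only [doubleSum]
    rw [integral_finsetSum _ fun _ _ =>
      integrable_finsetSum _ fun _ _ => integrable_kernelTerm _ _]
    refine Finset.sum_congr rfl fun i _ => ?_
    rw [integral_finsetSum _ fun _ _ => integrable_kernelTerm _ _]
  rw [h2, doubleSum_of_eq_zero fun j _ hj => by rw [h j, if_neg hj], h 0]
  simp [mul_comm]

/-! ### The multiplier and its second differences. -/

/-- The profile `(1 + u) / (1 + u²)` of the multiplier of the discrete operator. -/
noncomputable def profile (u : ℝ) : ℝ := (1 + u) / (1 + u ^ 2)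

/-- An exact formula that displays the factor `h ^ 2`, replacing a bound on the second derivative.
-/
theorem profile_secondDiff (u h : ℝ) :
    profile (u + h) - 2 * profile u + profile (u - h) =
      -2 * h ^ 2 * ((1 - u) * (2 * u) + (1 + u) * (1 - (u ^ 2 - h ^ 2))) /
        ((1 + u ^ 2) * ((1 + (u + h) ^ 2) * (1 + (u - h) ^ 2))) := by
  have h1 : 1 + u ^ 2 ≠ 0 := by positivity
  have h2 : 1 + (u + h) ^ 2 ≠ 0 := by positivity
  have h3 : 1 + (u - h) ^ 2 ≠ 0 := by positivity
  unfold profile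
  field_simp
  ring

theorem abs_profile_secondDiff_le {u h : ℝ} (h0 : 0 ≤ h) (h1 : u + h ≤ 1) (h2 : -1 ≤ u - h) :
    |profile (u + h) - 2 * profile u + profile (u - h)| ≤ 16 * h ^ 2 := by
  have hden : 1 ≤ (1 + u ^ 2) * ((1 + (u + h) ^ 2) * (1 + (u - h) ^ 2)) :=
    one_le_mul_of_one_le_of_one_le (by nlinarith)
      (one_le_mul_of_one_le_of_one_le (by nlinarith) (by nlinarith))
  rw [profile_secondDiff, abs_div, abs_of_pos (lt_of_lt_of_le one_pos hden)]
  refine (div_le_self (abs_nonneg _) hden).trans ?_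
  have hb : |(1 - u) * (2 * u) + (1 + u) * (1 - (u ^ 2 - h ^ 2))| ≤ 8 := by
    have a1 : |1 - u| ≤ 2 := abs_le.mpr ⟨by linarith, by linarith⟩
    have a2 : |2 * u| ≤ 2 := abs_le.mpr ⟨by linarith, by linarith⟩
    have a3 : |1 + u| ≤ 2 := abs_le.mpr ⟨by linarith, by linarith⟩
    have a4 : |1 - (u ^ 2 - h ^ 2)| ≤ 2 := abs_le.mpr ⟨by nlinarith, by nlinarith⟩
    calc _ ≤ |(1 - u) * (2 * u)| + |(1 + u) * (1 - (u ^ 2 - h ^ 2))| := abs_add_le _ _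
      _ = |1 - u| * |2 * u| + |1 + u| * |1 - (u ^ 2 - h ^ 2)| := by rw [abs_mul, abs_mul (1 + u)]
      _ ≤ 2 * 2 + 2 * 2 := by gcongr
      _ = 8 := by norm_num
  rw [abs_mul, abs_mul, abs_of_nonneg (sq_nonneg h)]
  norm_num
  nlinarith [sq_nonneg h]

/-- The multiplier of the discrete operator with respect to the Chebyshev kernel terms. -/
noncomputable def multiplier (n m j : ℕ) : ℝ :=
  if j + m ≤ n then 1 else if j < n + m then profile (((n : ℝ) - j) / m) else 0

theorem multiplier_of_add_le {n m j : ℕ} (h : j + m ≤ n) : multiplier n m j = 1 := if_pos h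

theorem multiplier_of_add_le_right {n m j : ℕ} (hm : 0 < m) (h : n + m ≤ j) :
    multiplier n m j = 0 := by
  rw [multiplier, if_neg (by omega), if_neg (by omega)]

/-- Both endpoints are allowed because `profile 1 = 1` and `profile (-1) = 0` match the neighbouring
constant values. -/
theorem multiplier_eq_profile {n m j : ℕ} (hm : 0 < m) (h1 : n ≤ j + m) (h2 : j ≤ n + m) :
    multiplier n m j = profile (((n : ℝ) - j) / m) := by
  have hm' : (m : ℝ) ≠ 0 := by positivity
  unfold multiplier
  split_ifs with h3 h4
  · have : (n : ℝ) = j + m := by exact_mod_cast le_antisymm h1 h3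
    rw [this, add_sub_cancel_left, div_self hm', profile]
    norm_num
  · rfl
  · have : (j : ℝ) = n + m := by exact_mod_cast (by omega : j = n + m)
    rw [this, sub_add_cancel_left, neg_div, div_self hm', profile]
    norm_num

/-- This and `abs_profile_sub_one_le` control the profile one step `1 / m` inside its endpoints,
which yields the corner terms. -/
theorem abs_profile_le {u : ℝ} (hu : -1 ≤ u) : |profile u| ≤ 1 + u := by
  have : (0 : ℝ) < 1 + u ^ 2 := by positivity
  rw [profile, abs_div, abs_of_nonneg (by linarith : 0 ≤ 1 + u), abs_of_pos this]
  exact div_le_self (by linarith) (by nlinarith)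

theorem abs_profile_sub_one_le {u : ℝ} (h0 : 0 ≤ u) (hu : u ≤ 1) : |profile u - 1| ≤ 1 - u := by
  have h : (0 : ℝ) < 1 + u ^ 2 := by positivity
  have : profile u - 1 = u * (1 - u) / (1 + u ^ 2) := by
    unfold profile; field_simp; ring
  rw [this, abs_of_nonneg (by have : 0 ≤ 1 - u := by linarith
                              positivity), div_le_iff₀ h]
  nlinarith

/-- The multiplier is continuous where its pieces meet but its slope jumps there, so the windows `k,
k+1, k+2` centred at `n - m` and `n + m` only give `1 / m`. Inside the band the step is `h = 1 / m`,
and elsewhere the difference is zero. -/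
theorem abs_secondDiff_multiplier_le {n m : ℕ} (hm : 0 < m) (hmn : m < n) (k : ℕ) :
    |secondDiff (multiplier n m) k| ≤
      (if k ∈ Finset.Ico (n - m) (n + m) then 16 * (1 / (m : ℝ)) ^ 2 else 0) +
        ((if k = n - m - 1 then 1 / (m : ℝ) else 0) + if k = n + m - 1 then 1 / (m : ℝ) else 0) := by
  have hm' : (0 : ℝ) < m := by positivity
  have hm1 : (1 : ℝ) ≤ m := by exact_mod_cast hm
  have e1 : (0 : ℝ) ≤ if k ∈ Finset.Ico (n - m) (n + m) then 16 * (1 / (m : ℝ)) ^ 2 else 0 := by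
    split_ifs <;> positivity
  have e2 : (0 : ℝ) ≤ if k = n - m - 1 then 1 / (m : ℝ) else 0 := by split_ifs <;> positivity
  have e3 : (0 : ℝ) ≤ if k = n + m - 1 then 1 / (m : ℝ) else 0 := by split_ifs <;> positivity
  unfold secondDiff
  rcases lt_or_ge (k + 1 + m) n with h | h
  · rw [multiplier_of_add_le (by omega), multiplier_of_add_le (by omega),
      multiplier_of_add_le (by omega)]
    rw [show (1 : ℝ) - 2 * 1 + 1 = 0 by norm_num, abs_zero]
    linarith
  rcases h.eq_or_lt with h | h
  · rw [multiplier_of_add_le (by omega), multiplier_of_add_le (by omega),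
      multiplier_eq_profile hm (by omega) (by omega)]
    have hn : (n : ℝ) = k + 1 + m := by exact_mod_cast h
    have hu : ((n : ℝ) - ((k + 2 : ℕ) : ℝ)) / m = 1 - 1 / m := by
      rw [hn]; push_cast; field_simp; ring
    have hle : 1 / (m : ℝ) ≤ 1 := by rw [div_le_one hm']; exact hm1
    have h4 := abs_profile_sub_one_le (u := 1 - 1 / (m : ℝ)) (by linarith)
      (by have : 0 < 1 / (m : ℝ) := by positivity
          linarith)
    rw [hu, show (1 : ℝ) - 2 * 1 + profile (1 - 1 / m) = profile (1 - 1 / m) - 1 by ring,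
      if_pos (show k = n - m - 1 by omega)]
    linarith
  rcases lt_or_ge (k + 1) (n + m) with h5 | h5
  · rw [if_pos (by simp; omega)]
    rw [multiplier_eq_profile hm (by omega) (by omega),
      multiplier_eq_profile hm (by omega) (by omega),
      multiplier_eq_profile hm (by omega) (by omega)]
    have h6 : (n : ℝ) ≤ k + m := by exact_mod_cast (by omega : n ≤ k + m)
    have h7 : (k : ℝ) + 2 ≤ n + m := by exact_mod_cast (by omega : k + 2 ≤ n + m)
    have := abs_profile_secondDiff_le (u := ((n : ℝ) - (k + 1 : ℕ)) / m) (h := 1 / m)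
      (by positivity)
      (by rw [← add_div, div_le_one hm']; push_cast; linarith)
      (by rw [← sub_div, le_div_iff₀ hm']; push_cast; linarith)
    rw [← add_div, ← sub_div] at this
    push_cast at this ⊢
    rw [show (n : ℝ) - (k + 1) + 1 = n - k by ring,
      show (n : ℝ) - (k + 1) - 1 = n - (k + 2) by ring] at this
    linarith
  rcases h5.eq_or_lt with h5 | h5
  · rw [multiplier_of_add_le_right hm (by omega : n + m ≤ k + 1),
      multiplier_of_add_le_right hm (by omega : n + m ≤ k + 2),
      multiplier_eq_profile hm (by omega) (by omega), if_pos (show k = n + m - 1 by omega)]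
    have hn : (k : ℝ) + 1 = n + m := by exact_mod_cast h5.symm
    have hu : ((n : ℝ) - k) / m = -1 + 1 / m := by
      rw [show (k : ℝ) = n + m - 1 by linarith]; field_simp; ring
    rw [hu, mul_zero, sub_zero, add_zero]
    have := abs_profile_le (u := -1 + 1 / (m : ℝ))
      (by have : 0 < 1 / (m : ℝ) := by positivity
          linarith)
    linarith
  · rw [multiplier_of_add_le_right hm (by omega), multiplier_of_add_le_right hm (by omega),
      multiplier_of_add_le_right hm (by omega), mul_zero, sub_zero, add_zero, abs_zero]
    linarith

theorem sum_abs_secondDiff_multiplier_le {n m : ℕ} (hm : 0 < m) (hmn : m < n) (N : ℕ) :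
    ∑ k ∈ Finset.range N, |secondDiff (multiplier n m) k| ≤ 34 / m := by
  have hm' : (0 : ℝ) < m := by positivity
  refine (Finset.sum_le_sum fun k _ => abs_secondDiff_multiplier_le hm hmn k).trans ?_
  rw [Finset.sum_add_distrib, Finset.sum_add_distrib]
  have h1 : ∑ k ∈ Finset.range N,
      (if k ∈ Finset.Ico (n - m) (n + m) then 16 * (1 / (m : ℝ)) ^ 2 else 0) ≤ 32 / (m : ℝ) := by
    rw [← Finset.sum_filter, Finset.sum_const, nsmul_eq_mul]
    -- The band has at most `2 m` indices, contributing `2 m * 16 / m² = 32 / m`; the two corners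
    -- add `2 / m`.
    have : ((Finset.range N).filter (· ∈ Finset.Ico (n - m) (n + m))).card ≤ 2 * m := by
      refine (Finset.card_le_card (t := Finset.Ico (n - m) (n + m)) ?_).trans ?_
      · intro k hk; exact (Finset.mem_filter.mp hk).2
      · rw [Nat.card_Ico]; omega
    calc _ ≤ ((2 * m : ℕ) : ℝ) * (16 * (1 / (m : ℝ)) ^ 2) := by gcongr
      _ = 32 / m := by push_cast; field_simp; norm_num
  have h2 : ∀ l : ℕ, ∑ k ∈ Finset.range N, (if k = l then 1 / (m : ℝ) else 0) ≤ 1 / m := by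
    intro l
    rw [Finset.sum_ite_eq']
    split_ifs
    · rfl
    · positivity
  have e : (34 : ℝ) / m = 32 / m + (1 / m + 1 / m) := by ring
  rw [e]
  gcongr <;> apply h2

/-! ### Discrete orthogonality and the kernel of the scaling functions. -/

theorem orthoCheb_mul_orthoCheb (r : ℕ) (y x : ℝ) :
    (orthoCheb r).eval y * (orthoCheb r).eval x = kernelTerm y x r / Real.pi := by
  have hpi := Real.pi_pos
  have h : (if r = 0 then √(1 / Real.pi) else √(2 / Real.pi)) *
      (if r = 0 then √(1 / Real.pi) else √(2 / Real.pi)) = cosWeight r / Real.pi := by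
    unfold cosWeight
    split_ifs <;> exact Real.mul_self_sqrt (by positivity)
  simp only [orthoCheb, eval_mul, eval_C, kernelTerm]
  linear_combination ((Chebyshev.T ℝ (r : ℤ)).eval y * (Chebyshev.T ℝ (r : ℤ)).eval x) * h

/-- By the product formula only `T_{r+s}` and `T_{r-s}` matter, and neither `r + s` nor `r - s` is a
multiple of `2 n`: both are nonzero and smaller than `2 n` in absolute value. -/
theorem sum_node_T_mul_T {n r s : ℕ} (hr : r < n) (hs : s < n) (hrs : r ≠ s) :
    ∑ i ∈ Finset.Icc 1 n, (Chebyshev.T ℝ (r : ℤ)).eval (node n i) *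
      (Chebyshev.T ℝ (s : ℤ)).eval (node n i) = 0 := by
  have hn : 0 < n := by omega
  have h (x : ℝ) : (Chebyshev.T ℝ (r : ℤ)).eval x * (Chebyshev.T ℝ (s : ℤ)).eval x =
      ((Chebyshev.T ℝ ((r : ℤ) + s)).eval x + (Chebyshev.T ℝ ((r : ℤ) - s)).eval x) / 2 := by
    have := congrArg (eval x) (Chebyshev.T_mul_T ℝ (r : ℤ) s)
    simp only [eval_mul, eval_add, eval_ofNat] at this
    linarith
  simp_rw [h]
  rw [← Finset.sum_div, Finset.sum_add_distrib, sum_eval_T_node hn, sum_eval_T_node hn]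
  · simp
  · rintro ⟨c, hc⟩
    have h1 : c < 1 := by nlinarith
    have h2 : -1 < c := by nlinarith
    have : c = 0 := by omega
    subst this
    omega
  · rintro ⟨c, hc⟩
    have h1 : c < 1 := by nlinarith
    have h2 : 0 < c := by
      have : (0 : ℤ) < r + s := by omega
      by_contra hcon
      nlinarith
    omega

theorem sum_node_kernelTerm_self {n r : ℕ} (hr : r < n) :
    ∑ i ∈ Finset.Icc 1 n, kernelTerm (node n i) (node n i) r = n := by
  have hn : 0 < n := by omega
  have h (x : ℝ) : kernelTerm x x r = 1 + (if r = 0 then 0 else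
      (Chebyshev.T ℝ ((2 * r : ℕ) : ℤ)).eval x) := by
    have := congrArg (eval x) (Chebyshev.T_mul_T ℝ (r : ℤ) r)
    simp only [eval_mul, eval_add, eval_ofNat, sub_self, Chebyshev.T_zero, eval_one] at this
    unfold kernelTerm cosWeight
    split_ifs with h0
    · simp [h0]
    · push_cast
      rw [two_mul (r : ℤ)]
      linarith
  simp_rw [h, Finset.sum_add_distrib]
  split_ifs with h0
  · simp
  · rw [sum_eval_T_node_of_lt hn (by omega), if_neg (by omega)]
    simp

theorem sum_node_orthoCheb_mul {n r s : ℕ} (hr : r < n) (hs : s < n) :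
    ∑ i ∈ Finset.Icc 1 n, (orthoCheb r).eval (node n i) * (orthoCheb s).eval (node n i) =
      if r = s then (n : ℝ) / Real.pi else 0 := by
  split_ifs with h
  · subst h
    simp_rw [orthoCheb_mul_orthoCheb]
    rw [← Finset.sum_div, sum_node_kernelTerm_self hr]
  · simp only [orthoCheb, eval_mul, eval_C]
    rw [← mul_zero ((if r = 0 then √(1 / Real.pi) else √(2 / Real.pi)) *
      (if s = 0 then √(1 / Real.pi) else √(2 / Real.pi))), ← sum_node_T_mul_T hr hs h,
      Finset.mul_sum]
    exact Finset.sum_congr rfl fun i _ => by ring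

theorem nu_pos {n m : ℕ} (hm : 0 < m) (r : ℕ) : 0 < nu n m r := by
  unfold nu
  split_ifs <;> positivity

/-- Summing over `k` pairs `p_r` with `p_s` at the nodes, so only `r = s` survives, with factor `π /
(n ν_r) * (n / π)`. -/
theorem sum_scaling_mul_scaling {n m : ℕ} (hm : 0 < m) (hn : 0 < n) (y x : ℝ) :
    ∑ k ∈ Finset.Icc 1 n, (scaling n m k).eval y * (scaling n m k).eval x =
      ∑ r ∈ Finset.range n, (nu n m r)⁻¹ * (q n m r).eval y * (q n m r).eval x := by
  have hn' : (0 : ℝ) < n := by positivity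
  have hpi := Real.pi_pos
  have hs (k : ℕ) (z : ℝ) : (scaling n m k).eval z =
      ∑ r ∈ Finset.range n, tau n m r k * (q n m r).eval z := by
    simp [scaling, eval_finsetSum]
  simp_rw [hs, Finset.sum_mul_sum]
  rw [Finset.sum_comm]
  refine Finset.sum_congr rfl fun r hr => ?_
  rw [Finset.sum_comm]
  have hr' := Finset.mem_range.mp hr
  have key (s : ℕ) (hs : s ∈ Finset.range n) : ∑ k ∈ Finset.Icc 1 n, tau n m r k *
      (q n m r).eval y * (tau n m s k * (q n m s).eval x) =
      if r = s then (nu n m r)⁻¹ * (q n m r).eval y * (q n m r).eval x else 0 := by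
    have h1 : ∀ k, tau n m r k * (q n m r).eval y * (tau n m s k * (q n m s).eval x) =
        (√(Real.pi / (n * nu n m r)) * √(Real.pi / (n * nu n m s)) * (q n m r).eval y *
          (q n m s).eval x) * ((orthoCheb r).eval (node n k) * (orthoCheb s).eval (node n k)) :=
      fun k => by unfold tau; ring
    simp_rw [h1]
    rw [← Finset.mul_sum, sum_node_orthoCheb_mul hr' (Finset.mem_range.mp hs)]
    split_ifs with h
    · subst h
      have hnu := nu_pos (n := n) hm r
      rw [Real.mul_self_sqrt (by positivity)]
      field_simp
    · simp
  rw [Finset.sum_congr rfl key, Finset.sum_ite_eq, if_pos hr]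

/-! ### Reflection `r ↦ 2n - r` at the nodes and the cardinal kernel. -/

theorem eval_T_two_mul_sub_node {n r : ℕ} (hn : 0 < n) (hr : r ≤ 2 * n) (i : ℕ) :
    (Chebyshev.T ℝ ((2 * n - r : ℕ) : ℤ)).eval (node n i) =
      -(Chebyshev.T ℝ (r : ℤ)).eval (node n i) := by
  have hn' : (n : ℝ) ≠ 0 := by positivity
  unfold node
  rw [Chebyshev.T_real_cos, Chebyshev.T_real_cos]
  push_cast [Nat.cast_sub hr]
  rw [show (2 * (n : ℝ) - r) * ((2 * (i : ℝ) - 1) * Real.pi / (2 * n)) =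
    ((i : ℕ) : ℝ) * (2 * Real.pi) - (Real.pi + r * ((2 * (i : ℝ) - 1) * Real.pi / (2 * n))) by
      field_simp; ring, Real.cos_nat_mul_two_pi_sub, add_comm, Real.cos_add_pi]

theorem eval_orthoCheb_two_mul_sub_node {n r : ℕ} (hr : r < n) (hr0 : r ≠ 0) (i : ℕ) :
    (orthoCheb (2 * n - r)).eval (node n i) = -(orthoCheb r).eval (node n i) := by
  simp only [orthoCheb, eval_mul, eval_C, if_neg hr0, if_neg (show 2 * n - r ≠ 0 by omega)]
  rw [eval_T_two_mul_sub_node (by omega) (by omega)]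
  ring

theorem kernelTerm_node_self {n : ℕ} (hn : 0 < n) (i : ℕ) (x : ℝ) :
    kernelTerm (node n i) x n = 0 := by
  have h := eval_T_two_mul_sub_node hn (show n ≤ 2 * n by omega) i
  rw [show 2 * n - n = n by omega] at h
  rw [kernelTerm, show (Chebyshev.T ℝ (n : ℤ)).eval (node n i) = 0 by linarith]
  ring

/-- The reflected term changes sign at the nodes, and `μ_r + μ_{2n-r} = 1`. -/
theorem eval_q_node {n m r : ℕ} (hm : 0 < m) (hmn : m < n) (hr : r < n) (i : ℕ) :
    (q n m r).eval (node n i) = (orthoCheb r).eval (node n i) := by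
  have hm' : (m : ℝ) ≠ 0 := by positivity
  unfold q
  split_ifs with h
  · rfl
  · simp only [eval_sub, eval_mul, eval_C]
    rw [eval_orthoCheb_two_mul_sub_node hr (by omega)]
    unfold mu
    rw [if_neg h, if_pos (by omega), if_neg (by omega), if_pos (by omega),
      Nat.cast_sub (by omega)]
    push_cast
    field_simp
    ring

/-- With `u = (n - r) / m`, the quotients `μ_r / ν_r` and `μ_{2n-r} / ν_r` are `profile u` and
`profile (-u)`. The minus sign in `q` cancels against the one from reflecting `p_{2n-r}` at the
node. -/
theorem inv_nu_mul_orthoCheb_mul_q {n m r : ℕ} (hm : 0 < m) (hmn : m < n) (hr : r < n) (i : ℕ)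
    (x : ℝ) :
    (nu n m r)⁻¹ * (orthoCheb r).eval (node n i) * (q n m r).eval x =
      (multiplier n m r * kernelTerm (node n i) x r +
        multiplier n m (2 * n - r) * kernelTerm (node n i) x (2 * n - r)) / Real.pi := by
  rcases le_or_gt (r + m) n with h | h
  · rw [multiplier_of_add_le h, multiplier_of_add_le_right hm (by omega), nu, if_pos h, q,
      if_pos h, inv_one, one_mul, orthoCheb_mul_orthoCheb]
    ring
  · have hm' : (0 : ℝ) < m := by positivity
    have hr2 : ((2 * n - r : ℕ) : ℝ) = 2 * n - r := by
      rw [Nat.cast_sub (by omega)]; push_cast; ring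
    rw [add_div, mul_div_assoc, mul_div_assoc, ← orthoCheb_mul_orthoCheb,
      ← orthoCheb_mul_orthoCheb, eval_orthoCheb_two_mul_sub_node hr (by omega),
      multiplier_eq_profile hm (by omega) (by omega),
      multiplier_eq_profile hm (by omega) (by omega), hr2, nu, if_neg (by omega), q,
      if_neg (by omega), mu, if_neg (by omega), if_pos (by omega), mu, if_neg (by omega),
      if_pos (by omega), hr2]
    simp only [eval_sub, eval_mul, eval_C, profile]
    have h1 : (m : ℝ) ^ 2 + ((n : ℝ) - r) ^ 2 ≠ 0 := by positivity
    have h2 : 1 + (((n : ℝ) - r) / m) ^ 2 = (m ^ 2 + ((n : ℝ) - r) ^ 2) / m ^ 2 := by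
      field_simp
    have h3 : 1 + (((n : ℝ) - (2 * n - r)) / m) ^ 2 = (m ^ 2 + ((n : ℝ) - r) ^ 2) / m ^ 2 := by
      field_simp; ring
    rw [h2, h3]
    field_simp
    ring

/-- Pairing `r` with `2 n - r` omits the index `n` and adds the index `2 n`. For the kernel, the
first term vanishes because `T_n` is zero at the nodes, the second because the multiplier is zero
there. -/
theorem sum_range_two_mul_eq {n : ℕ} (b : ℕ → ℝ) (h1 : b n = 0) (h2 : b (2 * n) = 0) :
    ∑ j ∈ Finset.range (2 * n), b j = ∑ r ∈ Finset.range n, (b r + b (2 * n - r)) := by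
  have h : ∑ j ∈ Finset.range (2 * n), b j = ∑ j ∈ Finset.range (n + 1 + n), b j := by
    rw [show n + 1 + n = 2 * n + 1 by ring, Finset.sum_range_succ, h2, add_zero]
  rw [h, Finset.sum_range_add, Finset.sum_range_succ, h1, add_zero, Finset.sum_add_distrib,
    ← Finset.sum_range_reflect (fun j => b (n + 1 + j))]
  congr 1
  refine Finset.sum_congr rfl fun j hj => ?_
  have := Finset.mem_range.mp hj
  congr 1
  omega

/-- The cardinal kernel of the discrete operator attached to the `i`-th node. -/
noncomputable def discreteKernel (n m i : ℕ) (x : ℝ) : ℝ :=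
  (1 / n) * ∑ k ∈ Finset.range (2 * n),
    secondDiff (multiplier n m) k * doubleSum (kernelTerm (node n i) x) (k + 1)

theorem sum_inv_nu_mul_eq_discreteKernel {n m : ℕ} (hm : 0 < m) (hmn : m < n) (i : ℕ) (x : ℝ) :
    Real.pi / n * ∑ r ∈ Finset.range n,
      (nu n m r)⁻¹ * (orthoCheb r).eval (node n i) * (q n m r).eval x =
      discreteKernel n m i x := by
  have hpi := Real.pi_pos
  have hn : (0 : ℝ) < n := by exact_mod_cast (by omega : 0 < n)
  rw [Finset.sum_congr rfl fun r hr =>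
    inv_nu_mul_orthoCheb_mul_q hm hmn (Finset.mem_range.mp hr) i x, ← Finset.sum_div,
    ← sum_range_two_mul_eq (fun j => multiplier n m j * kernelTerm (node n i) x j)
      (by simp only [kernelTerm_node_self (by omega : 0 < n), mul_zero])
      (by simp only [multiplier_of_add_le_right hm (by omega : n + m ≤ 2 * n), zero_mul]),
    sum_mul_eq_sum_secondDiff_mul_doubleSum _ _ _
      (multiplier_of_add_le_right hm (by omega : n + m ≤ 2 * n))
      (multiplier_of_add_le_right hm (by omega : n + m ≤ 2 * n + 1)), discreteKernel]
  field_simp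

theorem eval_discreteProj {n m : ℕ} (hm : 0 < m) (hmn : m < n) (f : ℝ → ℝ) (x : ℝ) :
    (discreteProj n m f).eval x = ∑ i ∈ Finset.Icc 1 n, f (node n i) * (Real.pi / n *
      ∑ r ∈ Finset.range n,
        (nu n m r)⁻¹ * (orthoCheb r).eval (node n i) * (q n m r).eval x) := by
  simp only [discreteProj, eval_finsetSum, eval_mul, eval_C]
  simp_rw [Finset.mul_sum (Finset.Icc 1 n), Finset.sum_mul]
  rw [Finset.sum_comm]
  refine Finset.sum_congr rfl fun i _ => ?_
  have h : ∑ r ∈ Finset.range n, (nu n m r)⁻¹ * (orthoCheb r).eval (node n i) * (q n m r).eval x =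
      ∑ k ∈ Finset.Icc 1 n, (scaling n m k).eval (node n i) * (scaling n m k).eval x := by
    rw [sum_scaling_mul_scaling hm (by omega)]
    exact Finset.sum_congr rfl fun r hr => by
      rw [eval_q_node hm hmn (Finset.mem_range.mp hr) i]
  rw [h, Finset.mul_sum, Finset.mul_sum]
  exact Finset.sum_congr rfl fun k _ => by ring

theorem eval_discreteProj_eq_sum_discreteKernel {n m : ℕ} (hm : 0 < m) (hmn : m < n) (f : ℝ → ℝ)
    (x : ℝ) :
    (discreteProj n m f).eval x =
      ∑ i ∈ Finset.Icc 1 n, f (node n i) * discreteKernel n m i x := by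
  simp_rw [eval_discreteProj hm hmn, sum_inv_nu_mul_eq_discreteKernel hm hmn]

/-! ### Polynomial reproduction and degree. -/

/-- Discrete orthogonality leaves only the term `r = s`, for which `ν_s = 1` and `q_s = p_s`. -/
theorem eval_discreteProj_orthoCheb {n m s : ℕ} (hm : 0 < m) (hmn : m < n) (hs : s + m ≤ n) (x : ℝ) :
    (discreteProj n m fun y => (orthoCheb s).eval y).eval x = (orthoCheb s).eval x := by
  have hpi := Real.pi_pos
  have hn : (0 : ℝ) < n := by exact_mod_cast (by omega : 0 < n)
  rw [eval_discreteProj hm hmn]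
  have h : ∀ i ∈ Finset.Icc 1 n, (orthoCheb s).eval (node n i) * (Real.pi / n *
      ∑ r ∈ Finset.range n, (nu n m r)⁻¹ * (orthoCheb r).eval (node n i) * (q n m r).eval x) =
      ∑ r ∈ Finset.range n, (Real.pi / n * (nu n m r)⁻¹ * (q n m r).eval x) *
        ((orthoCheb r).eval (node n i) * (orthoCheb s).eval (node n i)) := by
    intro i _
    rw [Finset.mul_sum, Finset.mul_sum]
    exact Finset.sum_congr rfl fun r _ => by ring
  rw [Finset.sum_congr rfl h, Finset.sum_comm,
    Finset.sum_eq_single_of_mem s (Finset.mem_range.mpr (by omega))]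
  · rw [← Finset.mul_sum, sum_node_orthoCheb_mul (by omega) (by omega), if_pos rfl, nu, if_pos hs,
      q, if_pos hs]
    field_simp
  · intro r hr hrs
    rw [← Finset.mul_sum, sum_node_orthoCheb_mul (Finset.mem_range.mp hr) (by omega), if_neg hrs,
      mul_zero]

theorem exists_eq_sum_orthoCheb (P : ℝ[X]) {N : ℕ} (hP : P.natDegree ≤ N) :
    ∃ c : ℕ → ℝ, P = ∑ s ∈ Finset.range (N + 1), C (c s) * orthoCheb s := by
  have hpi := Real.pi_pos
  have hmem : P ∈ degreeLT ℝ (N + 1) := by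
    rw [mem_degreeLT]
    exact lt_of_le_of_lt (natDegree_le_iff_degree_le.mp hP) (by exact_mod_cast Nat.lt_succ_self N)
  rw [← Sequence.span_degreeLT (Chebyshev.chebyshevTsequence ℝ) (by simp),
    show Set.Iio (N + 1) = Finset.range (N + 1) by simp,
    Submodule.mem_span_image_finset_iff_exists_fun'] at hmem
  obtain ⟨c, hc⟩ := hmem
  refine ⟨fun s => c s / (if s = 0 then √(1 / Real.pi) else √(2 / Real.pi)), ?_⟩
  rw [← hc]
  refine Finset.sum_congr rfl fun s _ => ?_
  have h : (if s = 0 then √(1 / Real.pi) else √(2 / Real.pi)) ≠ 0 := by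
    split_ifs <;> positivity
  rw [orthoCheb, ← mul_assoc, ← C_mul, div_mul_cancel₀ _ h, smul_eq_C_mul]
  rfl

theorem eval_discreteProj_polynomial {n m : ℕ} (hm : 0 < m) (hmn : m < n) {P : ℝ[X]}
    (hP : P.natDegree ≤ n - m) (x : ℝ) :
    (discreteProj n m fun y => P.eval y).eval x = P.eval x := by
  obtain ⟨c, rfl⟩ := exists_eq_sum_orthoCheb P hP
  rw [eval_discreteProj_eq_sum_discreteKernel hm hmn]
  simp only [eval_finsetSum, eval_mul, eval_C, Finset.sum_mul]
  rw [Finset.sum_comm]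
  refine Finset.sum_congr rfl fun s hs => ?_
  have := Finset.mem_range.mp hs
  rw [← eval_discreteProj_orthoCheb hm hmn (by omega : s + m ≤ n),
    eval_discreteProj_eq_sum_discreteKernel hm hmn, Finset.mul_sum]
  exact Finset.sum_congr rfl fun i _ => by ring

theorem natDegree_orthoCheb_le (r : ℕ) : (orthoCheb r).natDegree ≤ r :=
  (natDegree_C_mul_le _ _).trans (by rw [Chebyshev.natDegree_T]; simp)

theorem natDegree_discreteProj_le {n m : ℕ} (hm : 0 < m) (f : ℝ → ℝ) :
    (discreteProj n m f).natDegree ≤ n + m - 1 := by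
  refine natDegree_sum_le_of_forall_le _ _ fun k _ => (natDegree_C_mul_le _ _).trans ?_
  refine natDegree_sum_le_of_forall_le _ _ fun r hr => (natDegree_C_mul_le _ _).trans ?_
  have hr' := Finset.mem_range.mp hr
  unfold q
  split_ifs with h
  · exact (natDegree_orthoCheb_le r).trans (by omega)
  · refine (natDegree_sub_le _ _).trans (max_le ?_ ?_)
    · exact (natDegree_C_mul_le _ _).trans ((natDegree_orthoCheb_le _).trans (by omega))
    -- Here `r ≥ n - m + 1`, so the reflected degree `2 * n - r` is at most `n + m - 1`.
    · exact (natDegree_C_mul_le _ _).trans ((natDegree_orthoCheb_le _).trans (by omega))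

/-! ### Bounds for the kernel majorant. -/

/-- A nonnegative (on `[-1,1]`) majorant of the cardinal kernel. -/
noncomputable def kernelMajorant (n m i : ℕ) (x : ℝ) : ℝ :=
  (1 / n) * ∑ k ∈ Finset.range (2 * n),
    |secondDiff (multiplier n m) k| * doubleSum (kernelTerm (node n i) x) (k + 1)

theorem abs_discreteKernel_le (n m i : ℕ) {x : ℝ} (hx : x ∈ Set.Icc (-1 : ℝ) 1) :
    |discreteKernel n m i x| ≤ kernelMajorant n m i x := by
  rw [discreteKernel, kernelMajorant, abs_mul, abs_of_nonneg (by positivity : (0 : ℝ) ≤ 1 / n)]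
  gcongr
  refine (Finset.abs_sum_le_sum_abs _ _).trans (Finset.sum_le_sum fun k _ => ?_)
  rw [abs_mul, abs_of_nonneg (doubleSum_kernelTerm_nonneg (node_mem_Icc n i) hx _)]

theorem sum_abs_secondDiff_mul_le {n m : ℕ} (hm : 0 < m) (hmn : m < n) :
    ∑ k ∈ Finset.range (2 * n), |secondDiff (multiplier n m) k| * ((k + 1 : ℕ) : ℝ) ≤
      68 * n / m := by
  calc _ ≤ ∑ k ∈ Finset.range (2 * n), |secondDiff (multiplier n m) k| * (2 * n) := by
        refine Finset.sum_le_sum fun k hk => ?_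
        have : k + 1 ≤ 2 * n := Finset.mem_range.mp hk
        gcongr
        exact_mod_cast this
    _ ≤ 34 / m * (2 * n) := by
        rw [← Finset.sum_mul]
        gcongr
        exact sum_abs_secondDiff_multiplier_le hm hmn _
    _ = 68 * n / m := by ring

/-- The nodal sums of the Fejér-type kernels do not depend on `x`, which makes the bound uniform; it
is the same weighted sum of second differences as in `integral_kernelMajorant_le`. -/
theorem sum_kernelMajorant_le {n m : ℕ} (hm : 0 < m) (hmn : m < n) (x : ℝ) :
    ∑ i ∈ Finset.Icc 1 n, kernelMajorant n m i x ≤ 68 * n / m := by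
  have hn : (0 : ℝ) < n := by exact_mod_cast (by omega : 0 < n)
  refine le_of_eq_of_le ?_ (sum_abs_secondDiff_mul_le hm hmn)
  simp only [kernelMajorant]
  rw [← Finset.mul_sum, Finset.sum_comm, Finset.mul_sum]
  refine Finset.sum_congr rfl fun k hk => ?_
  rw [← Finset.mul_sum, sum_node_doubleSum_kernelTerm (by omega) x (Finset.mem_range.mp hk)]
  field_simp

theorem integrable_kernelMajorant (n m i : ℕ) :
    Integrable (kernelMajorant n m i) Chebyshev.measureT :=
  (integrable_finsetSum _ fun _ _ =>
    (integrable_doubleSum_kernelTerm _ _).const_mul _).const_mul _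

theorem integral_kernelMajorant_le {n m : ℕ} (hm : 0 < m) (hmn : m < n) (i : ℕ) :
    ∫ x, kernelMajorant n m i x ∂Chebyshev.measureT ≤ 68 * n / m * (Real.pi / n) := by
  have hpi := Real.pi_pos
  simp only [kernelMajorant]
  rw [integral_const_mul, integral_finsetSum _ fun _ _ =>
    (integrable_doubleSum_kernelTerm _ _).const_mul _]
  simp_rw [integral_const_mul, integral_doubleSum_kernelTerm]
  calc _ = (∑ k ∈ Finset.range (2 * n), |secondDiff (multiplier n m) k| * ((k + 1 : ℕ) : ℝ)) *
        (Real.pi / n) := by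
        rw [Finset.mul_sum, Finset.sum_mul]
        exact Finset.sum_congr rfl fun k _ => by ring
    _ ≤ _ := by
        gcongr
        exact sum_abs_secondDiff_mul_le hm hmn

theorem kernelMajorant_nonneg (n m i : ℕ) {x : ℝ} (hx : x ∈ Set.Icc (-1 : ℝ) 1) :
    0 ≤ kernelMajorant n m i x :=
  (abs_nonneg _).trans (abs_discreteKernel_le n m i hx)

/-! ### Schur's test and the norm bound. -/

/-- Schur's test for a finite sum of kernels. -/
theorem eLpNorm_le_of_enorm_le_sum {α ι : Type*} [MeasurableSpace α] {μ : Measure α}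
    {s : Finset ι} {K : ι → α → ℝ≥0∞} {a : ι → ℝ≥0∞} {F : α → ℝ} {A D p : ℝ≥0∞} (hp : 1 ≤ p)
    (hp' : p ≠ ∞) (hK : ∀ i ∈ s, AEMeasurable (K i) μ) (hA : ∀ᵐ x ∂μ, ∑ i ∈ s, K i x ≤ A)
    (hD : ∀ i ∈ s, ∫⁻ x, K i x ∂μ ≤ A * D) (hF : ∀ᵐ x ∂μ, ‖F x‖ₑ ≤ ∑ i ∈ s, K i x * a i) :
    eLpNorm F p μ ≤ A * (D * ∑ i ∈ s, a i ^ p.toReal) ^ (1 / p.toReal) := by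
  have hp0 : p ≠ 0 := (one_pos.trans_le hp).ne'
  have hr : 1 ≤ p.toReal := by
    rw [← ENNReal.toReal_one]; exact ENNReal.toReal_mono hp' hp
  rw [eLpNorm_eq_lintegral_rpow_enorm_toReal hp0 hp']
  set r := p.toReal
  have hr0 : 0 < r := by linarith
  -- Hölder's inequality with weights `K i x` leaves the power `A ^ (r - 1)`; integrating each `K i`
  -- then supplies the missing factor `A` together with the quadrature weight `D`.
  have hpt : ∀ᵐ x ∂μ, ‖F x‖ₑ ^ r ≤ A ^ (r - 1) * ∑ i ∈ s, K i x * a i ^ r := by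
    filter_upwards [hA, hF] with x hx hFx
    calc ‖F x‖ₑ ^ r ≤ (∑ i ∈ s, K i x * a i) ^ r := by gcongr
      _ ≤ ((∑ i ∈ s, K i x) ^ (1 - r⁻¹) * (∑ i ∈ s, K i x * a i ^ r) ^ r⁻¹) ^ r := by
          gcongr
          exact ENNReal.inner_le_weight_mul_Lp_of_nonneg s hr _ _
      _ = (∑ i ∈ s, K i x) ^ (r - 1) * ∑ i ∈ s, K i x * a i ^ r := by
          rw [ENNReal.mul_rpow_of_nonneg _ _ hr0.le, ← ENNReal.rpow_mul, ← ENNReal.rpow_mul,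
            inv_mul_cancel₀ hr0.ne', ENNReal.rpow_one, sub_mul, one_mul, inv_mul_cancel₀ hr0.ne']
      _ ≤ A ^ (r - 1) * ∑ i ∈ s, K i x * a i ^ r := by
          gcongr
  have hint : ∫⁻ x, ‖F x‖ₑ ^ r ∂μ ≤ A ^ r * (D * ∑ i ∈ s, a i ^ r) := by
    calc ∫⁻ x, ‖F x‖ₑ ^ r ∂μ ≤ ∫⁻ x, A ^ (r - 1) * ∑ i ∈ s, K i x * a i ^ r ∂μ :=
          lintegral_mono_ae hpt
      _ = A ^ (r - 1) * ∑ i ∈ s, (∫⁻ x, K i x ∂μ) * a i ^ r := by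
          rw [lintegral_const_mul'' _
            (Finset.aemeasurable_fun_sum s fun i hi => (hK i hi).mul_const _),
            lintegral_finsetSum' _ fun i hi => (hK i hi).mul_const _]
          congr 1
          exact Finset.sum_congr rfl fun i hi => lintegral_mul_const'' _ (hK i hi)
      _ ≤ A ^ (r - 1) * ∑ i ∈ s, (A * D) * a i ^ r := by
          gcongr with i hi
          exact hD i hi
      _ = A ^ r * (D * ∑ i ∈ s, a i ^ r) := by
          have : A ^ r = A ^ (r - 1) * A := by
            conv_rhs => rw [← ENNReal.rpow_one A, ← ENNReal.rpow_mul, one_mul,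
              ← ENNReal.rpow_add_of_nonneg _ _ (by linarith) zero_le_one]
            congr 1
            ring
          rw [this, ← Finset.mul_sum]
          ring
  calc _ ≤ (A ^ r * (D * ∑ i ∈ s, a i ^ r)) ^ (1 / r) := by gcongr
    _ = A * (D * ∑ i ∈ s, a i ^ r) ^ (1 / r) := by
      rw [ENNReal.mul_rpow_of_nonneg _ _ (by positivity), ← ENNReal.rpow_mul,
        mul_one_div_cancel hr0.ne', ENNReal.rpow_one]

theorem ae_measureT_mem_Icc : ∀ᵐ x ∂Chebyshev.measureT, x ∈ Set.Icc (-1 : ℝ) 1 :=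
  (ae_restrict_mem measurableSet_Ioc).mono fun _ hx => Set.Ioc_subset_Icc_self hx

theorem abs_eval_discreteProj_le {n m : ℕ} (hm : 0 < m) (hmn : m < n) (f : ℝ → ℝ) {x : ℝ}
    (hx : x ∈ Set.Icc (-1 : ℝ) 1) :
    |(discreteProj n m f).eval x| ≤
      ∑ i ∈ Finset.Icc 1 n, kernelMajorant n m i x * |f (node n i)| := by
  rw [eval_discreteProj_eq_sum_discreteKernel hm hmn]
  refine (Finset.abs_sum_le_sum_abs _ _).trans (Finset.sum_le_sum fun i _ => ?_)
  rw [abs_mul, mul_comm]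
  exact mul_le_mul_of_nonneg_right (abs_discreteKernel_le n m i hx) (abs_nonneg _)

theorem enorm_eval_discreteProj_le {n m : ℕ} (hm : 0 < m) (hmn : m < n) (f : ℝ → ℝ) {x : ℝ}
    (hx : x ∈ Set.Icc (-1 : ℝ) 1) :
    ‖(discreteProj n m f).eval x‖ₑ ≤
      ∑ i ∈ Finset.Icc 1 n, ENNReal.ofReal (kernelMajorant n m i x) * ‖f (node n i)‖ₑ := by
  rw [Real.enorm_eq_ofReal_abs]
  refine (ENNReal.ofReal_le_ofReal (abs_eval_discreteProj_le hm hmn f hx)).trans_eq ?_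
  rw [ENNReal.ofReal_sum_of_nonneg fun i _ =>
    mul_nonneg (kernelMajorant_nonneg n m i hx) (abs_nonneg _)]
  refine Finset.sum_congr rfl fun i _ => ?_
  rw [ENNReal.ofReal_mul (kernelMajorant_nonneg n m i hx), Real.enorm_eq_ofReal_abs]

theorem sum_ofReal_kernelMajorant_le {n m : ℕ} (hm : 0 < m) (hmn : m < n) {x : ℝ}
    (hx : x ∈ Set.Icc (-1 : ℝ) 1) :
    ∑ i ∈ Finset.Icc 1 n, ENNReal.ofReal (kernelMajorant n m i x) ≤
      ENNReal.ofReal (68 * n / m) := by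
  rw [← ENNReal.ofReal_sum_of_nonneg fun i _ => kernelMajorant_nonneg n m i hx]
  exact ENNReal.ofReal_le_ofReal (sum_kernelMajorant_le hm hmn x)

theorem wNorm_discreteProj_le {n m : ℕ} (hm : 0 < m) (hmn : m < n) {p : ℝ≥0∞} (hp : 1 ≤ p)
    (f : ℝ → ℝ) :
    wNorm p (fun x => (discreteProj n m f).eval x) ≤
      ENNReal.ofReal (68 * n / m) * discreteNorm p n f := by
  unfold wNorm discreteNorm
  split_ifs with h
  · refine iSup₂_le fun x hx => (enorm_eval_discreteProj_le hm hmn f hx).trans ?_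
    calc _ ≤ ∑ i ∈ Finset.Icc 1 n, ENNReal.ofReal (kernelMajorant n m i x) *
          ⨆ k ∈ Finset.Icc 1 n, ‖f (node n k)‖ₑ := by
          gcongr with i hi
          exact le_iSup₂ (f := fun k (_ : k ∈ Finset.Icc 1 n) => ‖f (node n k)‖ₑ) i hi
      _ ≤ _ := by
          rw [← Finset.sum_mul]
          gcongr
          exact sum_ofReal_kernelMajorant_le hm hmn hx
  · refine eLpNorm_le_of_enorm_le_sum (K := fun i x => ENNReal.ofReal (kernelMajorant n m i x))
      hp h (fun i _ => (integrable_kernelMajorant n m i).aemeasurable.ennreal_ofReal)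
      (ae_measureT_mem_Icc.mono fun x hx => sum_ofReal_kernelMajorant_le hm hmn hx)
      (fun i _ => ?_)
      (ae_measureT_mem_Icc.mono fun x hx => enorm_eval_discreteProj_le hm hmn f hx)
    rw [← ofReal_integral_eq_lintegral_ofReal (integrable_kernelMajorant n m i)
      (ae_measureT_mem_Icc.mono fun x hx => kernelMajorant_nonneg n m i hx),
      ← ENNReal.ofReal_mul (by positivity)]
    exact ENNReal.ofReal_le_ofReal (integral_kernelMajorant_le hm hmn i)

/-! ### Error estimates. -/

/-- Lebesgue's argument: `P` is reproduced, so the error for `f` equals the error for `f - P`, which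
is at most the operator bound plus one times `M`. -/
theorem abs_eval_discreteProj_sub_le {n m : ℕ} (hm : 0 < m) (hmn : m < n) {f : ℝ → ℝ} {P : ℝ[X]}
    (hP : P.natDegree ≤ n - m) {M : ℝ} (hM : ∀ x ∈ Set.Icc (-1 : ℝ) 1, |f x - P.eval x| ≤ M)
    {x : ℝ} (hx : x ∈ Set.Icc (-1 : ℝ) 1) :
    |(discreteProj n m f).eval x - f x| ≤ (68 * n / m + 1) * M := by
  have hM0 : 0 ≤ M := (abs_nonneg _).trans (hM x hx)
  have hsub : (discreteProj n m fun y => f y - P.eval y).eval x =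
      (discreteProj n m f).eval x - P.eval x := by
    conv_rhs => rw [← eval_discreteProj_polynomial hm hmn hP x]
    simp only [eval_discreteProj_eq_sum_discreteKernel hm hmn, sub_mul, Finset.sum_sub_distrib]
  have h1 : |(discreteProj n m fun y => f y - P.eval y).eval x| ≤ 68 * n / m * M := by
    refine (abs_eval_discreteProj_le hm hmn _ hx).trans ?_
    calc _ ≤ ∑ i ∈ Finset.Icc 1 n, kernelMajorant n m i x * M :=
          Finset.sum_le_sum fun i _ => mul_le_mul_of_nonneg_left (hM _ (node_mem_Icc n i))
            (kernelMajorant_nonneg n m i hx)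
      _ ≤ _ := by
          rw [← Finset.sum_mul]
          exact mul_le_mul_of_nonneg_right (sum_kernelMajorant_le hm hmn x) hM0
  calc _ = |(discreteProj n m fun y => f y - P.eval y).eval x - (f x - P.eval x)| := by
        rw [hsub]; congr 1; ring
    _ ≤ 68 * n / m * M + M := (abs_sub _ _).trans (add_le_add h1 (hM x hx))
    _ = _ := by ring

theorem wNorm_top_discreteProj_sub_le {n m : ℕ} (hm : 0 < m) (hmn : m < n) (f : ℝ → ℝ) :
    wNorm ∞ (fun x => (discreteProj n m f).eval x - f x) ≤
      ENNReal.ofReal (68 * n / m + 1) * bestApprox (n - m) ∞ f := by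
  have hA : (0 : ℝ) < 68 * n / m + 1 := by positivity
  rw [bestApprox, ENNReal.mul_iInf_of_ne (by simpa using hA) ENNReal.ofReal_ne_top]
  refine le_iInf fun P => ?_
  simp only [wNorm, if_true]
  set W := ⨆ x ∈ Set.Icc (-1 : ℝ) 1, ‖f x - P.1.eval x‖ₑ with hW
  -- An infinite distance makes the right side infinite, since its other factor is positive;
  -- otherwise `W` is a real bound.
  rcases eq_or_ne W ∞ with h | h
  · rw [h, ENNReal.mul_top (by simpa using hA)]
    exact le_top
  refine iSup₂_le fun x hx => ?_
  have hM : ∀ y ∈ Set.Icc (-1 : ℝ) 1, |f y - P.1.eval y| ≤ W.toReal := by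
    intro y hy
    have := le_iSup₂ (f := fun y (_ : y ∈ Set.Icc (-1 : ℝ) 1) => ‖f y - P.1.eval y‖ₑ) y hy
    rw [← hW, Real.enorm_eq_ofReal_abs] at this
    exact (ENNReal.ofReal_le_iff_le_toReal h).mp this
  rw [Real.enorm_eq_ofReal_abs, ← ENNReal.ofReal_toReal h, ← ENNReal.ofReal_mul hA.le]
  exact ENNReal.ofReal_le_ofReal (abs_eval_discreteProj_sub_le hm hmn P.2 hM hx)

theorem bestApprox_le_wNorm_discreteProj_sub {n m : ℕ} (hm : 0 < m) (p : ℝ≥0∞) (f : ℝ → ℝ) :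
    bestApprox (n + m - 1) p f ≤ wNorm p (fun x => (discreteProj n m f).eval x - f x) := by
  refine (iInf_le _ ⟨discreteProj n m f, natDegree_discreteProj_le hm f⟩).trans_eq ?_
  unfold wNorm
  split_ifs
  · simp_rw [enorm_sub_rev (f _)]
  · exact eLpNorm_sub_comm f (fun x => (discreteProj n m f).eval x) _ _

/-! ### The choice `m = ⌊θ n⌋` and uniform convergence. -/

theorem floor_mul_lt {θ : ℝ} (hθ0 : 0 < θ) (hθ1 : θ < 1) {n : ℕ} (h : 1 ≤ ⌊θ * (n : ℝ)⌋₊) :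
    ⌊θ * (n : ℝ)⌋₊ < n := by
  have hn : 0 < n := Nat.pos_of_ne_zero (by rintro rfl; simp at h)
  have hn' : (0 : ℝ) < n := by exact_mod_cast hn
  exact (Nat.floor_lt (by positivity)).mpr (by nlinarith)

/-- Since `m ≥ 1`, `θ n < m + 1 ≤ 2 m`, hence `n / m ≤ 2 / θ`. -/
theorem div_floor_mul_le {θ : ℝ} (hθ0 : 0 < θ) {n : ℕ} (h : 1 ≤ ⌊θ * (n : ℝ)⌋₊) :
    68 * (n : ℝ) / ⌊θ * (n : ℝ)⌋₊ ≤ 136 / θ := by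
  have h1 : (1 : ℝ) ≤ ⌊θ * (n : ℝ)⌋₊ := by exact_mod_cast h
  have h2 := Nat.lt_floor_add_one (θ * (n : ℝ))
  rw [div_le_div_iff₀ (by linarith) hθ0]
  linarith

theorem tendstoUniformlyOn_discreteProj {θ : ℝ} (hθ0 : 0 < θ) (hθ1 : θ < 1) {f : ℝ → ℝ}
    (hf : ContinuousOn f (Set.Icc (-1 : ℝ) 1)) :
    TendstoUniformlyOn (fun (n : ℕ) (x : ℝ) => (discreteProj n ⌊θ * (n : ℝ)⌋₊ f).eval x)
      f atTop (Set.Icc (-1 : ℝ) 1) := by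
  rw [Metric.tendstoUniformlyOn_iff]
  intro ε hε
  have hC : 0 < 136 / θ + 1 := by positivity
  -- The tolerance is `ε / 2` divided by the uniform error constant `136 / θ + 1`; the half makes
  -- the final inequality strict.
  obtain ⟨P, hP⟩ := exists_polynomial_near_of_continuousOn (-1) 1 f hf (ε / (2 * (136 / θ + 1)))
    (by positivity)
  have hm : ∀ᶠ n : ℕ in atTop, 1 ≤ ⌊θ * (n : ℝ)⌋₊ :=
    (tendsto_nat_floor_atTop.comp
      (tendsto_natCast_atTop_atTop.const_mul_atTop hθ0)).eventually_ge_atTop 1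
  -- Since `n - m ≥ (1 - θ) n`, the fixed polynomial `P` is eventually reproduced.
  have hd : ∀ᶠ n : ℕ in atTop, (P.natDegree : ℝ) ≤ (1 - θ) * n :=
    (tendsto_natCast_atTop_atTop.const_mul_atTop (by linarith)).eventually_ge_atTop _
  filter_upwards [hm, hd] with n hm hd x hx
  have hlt := floor_mul_lt hθ0 hθ1 hm
  have hdeg : P.natDegree ≤ n - ⌊θ * (n : ℝ)⌋₊ := by
    have h1 := Nat.floor_le (by positivity : 0 ≤ θ * (n : ℝ))
    have h2 : ((P.natDegree + ⌊θ * (n : ℝ)⌋₊ : ℕ) : ℝ) ≤ n := by push_cast; linarith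
    have h3 : P.natDegree + ⌊θ * (n : ℝ)⌋₊ ≤ n := by exact_mod_cast h2
    omega
  rw [dist_comm, Real.dist_eq]
  calc _ ≤ (68 * (n : ℝ) / ⌊θ * (n : ℝ)⌋₊ + 1) * (ε / (2 * (136 / θ + 1))) :=
        abs_eval_discreteProj_sub_le hm hlt hdeg
          (fun y hy => by rw [abs_sub_comm]; exact (hP y hy).le) hx
    _ ≤ (136 / θ + 1) * (ε / (2 * (136 / θ + 1))) := by
        exact mul_le_mul_of_nonneg_right (by linarith [div_floor_mul_le hθ0 hm]) (by positivity)
    _ = ε / 2 := by field_simp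
    _ < ε := half_lt_self hε

end VP

theorem theorem3p3 (θ : ℝ) (hθ0 : 0 < θ) (hθ1 : θ < 1) :
    (∀ p : ℝ≥0∞, 1 ≤ p →
      ∃ Cp : ℝ≥0, 0 < Cp ∧
        ∀ n m : ℕ, m = ⌊θ * (n : ℝ)⌋₊ → 1 ≤ m → ∀ f : ℝ → ℝ,
          VP.wNorm p (fun x => (VP.discreteProj n m f).eval x) ≤
            (Cp : ℝ≥0∞) * VP.discreteNorm p n f) ∧
    (∀ f : ℝ → ℝ, ContinuousOn f (Set.Icc (-1 : ℝ) 1) →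
      TendstoUniformlyOn
        (fun (n : ℕ) (x : ℝ) => (VP.discreteProj n ⌊θ * (n : ℝ)⌋₊ f).eval x)
        f atTop (Set.Icc (-1 : ℝ) 1)) ∧
    (∃ C : ℝ≥0, 0 < C ∧
      ∀ n m : ℕ, m = ⌊θ * (n : ℝ)⌋₊ → 1 ≤ m →
        ∀ f : ℝ → ℝ, ContinuousOn f (Set.Icc (-1 : ℝ) 1) →
          VP.bestApprox (n + m - 1) ∞ f ≤
            VP.wNorm ∞ (fun x => (VP.discreteProj n m f).eval x - f x) ∧
          VP.wNorm ∞ (fun x => (VP.discreteProj n m f).eval x - f x) ≤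
            (C : ℝ≥0∞) * VP.bestApprox (n - m) ∞ f) := by
  have hpos : 0 < 136 / θ := by positivity
  refine ⟨fun p hp => ⟨(136 / θ).toNNReal, Real.toNNReal_pos.mpr hpos, ?_⟩,
    fun f hf => VP.tendstoUniformlyOn_discreteProj hθ0 hθ1 hf,
    ⟨(136 / θ + 1).toNNReal, Real.toNNReal_pos.mpr (by positivity), ?_⟩⟩
  · rintro n m rfl hm f
    refine (VP.wNorm_discreteProj_le hm (VP.floor_mul_lt hθ0 hθ1 hm) hp f).trans ?_
    exact mul_le_mul_left (ENNReal.ofReal_le_ofReal (VP.div_floor_mul_le hθ0 hm)) _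
  · rintro n m rfl hm f -
    refine ⟨VP.bestApprox_le_wNorm_discreteProj_sub hm ∞ f,
      (VP.wNorm_top_discreteProj_sub_le hm (VP.floor_mul_lt hθ0 hθ1 hm) f).trans ?_⟩
    exact mul_le_mul_left
      (ENNReal.ofReal_le_ofReal (by linarith [VP.div_floor_mul_le hθ0 hm])) _
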